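/- Let $p>3$ be a prime and let $R_p$ be the ring of rational numbers whose denominator is coprime to $p$. Congruences between elements of $R_p$ are taken in $R_p$: $a\equiv b\pmod{p^r}$ means $a-b\in p^rR_p$. For $a\in R_p$ let $\left(\frac ap\right)$ be the Legendre symbol of the residue class of $a$ in $R_p/pR_p\cong\mathbb Z/p\mathbb Z$ (so it is $0$ if $a\equiv 0\pmod p$). Let $m,n\in R_p$ with $m\not\equiv 0\pmod p$. Then $$\Big(\sum_{x=0}^{p-1}\Big(\frac{x^3+mx+n}p\Big)\Big)^2\equiv\Big(\frac{-3m}p\Big)\sum_{k=0}^{p-1}\binom{2k}k\binom{3k}k\binom{6k}{3k}\Big(\frac{4m^3+27n^2}{12^3\cdot 4m^3}\Big)^k$$ $$\equiv\Big(\frac{-3m}p\Big)\sum_{k=0}^{\lfloor p/6\rfloor}\binom{2k}k\binom{3k}k\binom{6k}{3k}\Big(\frac{4m^3+27n^2}{12^3\cdot 4m^3}\Big)^k\pmod p.$$ Moreover, if $\sum_{x=0}^{p-1}\left(\frac{x^3+mx+n}p\right)=0$, then $$\sum_{k=0}^{p-1}\binom{2k}k\binom{3k}k\binom{6k}{3k}\Big(\frac{4m^3+27n^2}{12^3\cdot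 4m^3}\Big)^k\equiv 0\pmod{p^2}.$$ -/

import Mathlib

/-- `R_p`: the rational numbers whose denominator is coprime to `p`. -/
def ratR (p : ℕ) : Set ℚ := {a | Nat.Coprime a.den p}

/-- `a ≡ b (mod N)` in the ring `R_p`: the difference `a - b` is `N` times an element of `R_p`. -/
def RatCong (p N : ℕ) (a b : ℚ) : Prop := ∃ c ∈ ratR p, a - b = (N : ℚ) * c

/-- The Legendre symbol `(a/p)` for `a ∈ R_p`: the quadratic character of the residue class of `a`
in `ℤ/pℤ`. The cast `ℚ → ZMod p` is numerator over denominator in the field `ZMod p`. For an integer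
`a` this is Mathlib's `legendreSym p a`. -/
def ratLegendre (p : ℕ) [Fact p.Prime] (a : ℚ) : ℤ := quadraticChar (ZMod p) (a : ZMod p)

/-- The character sum `∑_{x=0}^{p-1} ((x³ + m x + n)/p)`. -/
def cubicCharSum (p : ℕ) [Fact p.Prime] (m n : ℚ) : ℤ :=
  ∑ x ∈ Finset.range p, ratLegendre p ((x : ℚ) ^ 3 + m * (x : ℚ) + n)

/-- The sum `∑_{0 ≤ k < N} C(2k,k) C(3k,k) C(6k,3k) z^k`. -/
def binomSum (N : ℕ) (z : ℚ) : ℚ :=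
  ∑ k ∈ Finset.range N,
    ((Nat.choose (2 * k) k * Nat.choose (3 * k) k * Nat.choose (6 * k) (3 * k) : ℕ) : ℚ) * z ^ k

/-! Write `a_k = C(3k,k) C(6k,3k)`, `b_k = C(2k,k) a_k`, and parametrize `m = -3u²`, `n = 2u³(1 -
864x)`. Then the argument of the binomial sum is `z = x - 432x²`, and two facts meet at `f = ∑_{k<p}
a_k x^k`.

Clausen: `(∑ a_k x^k)² = ∑ b_k (x - 432x²)^k` as power series, both sides being killed by the same
third-order operator (`sexticSeries_sq`). The `a_k` and `b_k` carry enough factors `p` for the sums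
truncated at `p` to agree modulo `p²` (`prime_sq_dvd_clausen`).

Character sum: by Euler's criterion it is minus the coefficient of `X^(p-1)` in `(X³ + mX +
n)^((p-1)/2)`. Scaling `X` by `u` turns the cubic into `u³((X-1)²(X+2) - 1728x)`, and the binomial
expansion gives `-u^((p-1)/2) (3/p) f` modulo `p` (`sum_quadraticChar_cubic`).

Squaring gives the congruence modulo `p`, as `-3m = (3u)²`. If the character sum is zero, then `p`
divides `f`, so `p²` divides `f²`, which Clausen identifies with the binomial sum. Since `-m/3` need
not be a square, all this takes place in `(ℤ/p²)[u]/(u² + m/3)`, into which `ℤ/p²` embeds. -/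

/-- The coefficients `C(3k,k) C(6k,3k)` of the hypergeometric series `₂F₁(1/6, 5/6; 1; 432 x)`. -/
def sexticCoeff (k : ℕ) : ℕ := Nat.choose (3 * k) k * Nat.choose (6 * k) (3 * k)

/-- The coefficients `C(2k,k) C(3k,k) C(6k,3k)` of `₃F₂(1/6, 1/2, 5/6; 1, 1; 1728 z)`. -/
def sexticCubicCoeff (k : ℕ) : ℕ :=
  Nat.choose (2 * k) k * Nat.choose (3 * k) k * Nat.choose (6 * k) (3 * k)

/-! ### Recurrences for the coefficients -/

lemma sexticCubicCoeff_eq (k : ℕ) :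
    sexticCubicCoeff k = Nat.centralBinom k * sexticCoeff k := by
  rw [sexticCubicCoeff, sexticCoeff, Nat.centralBinom, mul_assoc]

lemma sexticCoeff_mul_factorial (k : ℕ) :
    sexticCoeff k * (k.factorial * (2 * k).factorial * (3 * k).factorial) = (6 * k).factorial := by
  have h1 := Nat.choose_mul_factorial_mul_factorial (show k ≤ 3 * k by omega)
  have h2 := Nat.choose_mul_factorial_mul_factorial (show 3 * k ≤ 6 * k by omega)
  rw [show 3 * k - k = 2 * k by omega] at h1
  rw [show 6 * k - 3 * k = 3 * k by omega] at h2
  calc sexticCoeff k * (k.factorial * (2 * k).factorial * (3 * k).factorial)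
      = (6 * k).choose (3 * k) *
          ((3 * k).choose k * k.factorial * (2 * k).factorial) * (3 * k).factorial := by
        rw [sexticCoeff]; ring
    _ = (6 * k).factorial := by rw [h1, h2]

lemma sexticCoeff_succ (k : ℕ) :
    (k + 1) ^ 2 * sexticCoeff (k + 1) = 12 * ((6 * k + 1) * (6 * k + 5)) * sexticCoeff k := by
  have h1 := sexticCoeff_mul_factorial k
  have h2 := sexticCoeff_mul_factorial (k + 1)
  rw [show 6 * (k + 1) = 6 * k + 1 + 1 + 1 + 1 + 1 + 1 by ring,
    show 2 * (k + 1) = 2 * k + 1 + 1 by ring, show 3 * (k + 1) = 3 * k + 1 + 1 + 1 by ring] at h2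
  simp only [Nat.factorial_succ] at h2
  rw [← h1] at h2
  have hpos : 0 < 6 * (k + 1) * (2 * k + 1) * (3 * k + 1) * (3 * k + 2) *
      (k.factorial * (2 * k).factorial * (3 * k).factorial) := by positivity
  apply Nat.eq_of_mul_eq_mul_left hpos
  linear_combination h2

lemma sexticCubicCoeff_succ (k : ℕ) :
    (k + 1) ^ 3 * sexticCubicCoeff (k + 1) =
      24 * ((6 * k + 1) * (2 * k + 1) * (6 * k + 5)) * sexticCubicCoeff k := by
  have h1 := sexticCoeff_succ k
  have h2 := Nat.succ_mul_centralBinom_succ k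
  rw [sexticCubicCoeff_eq, sexticCubicCoeff_eq]
  calc (k + 1) ^ 3 * (Nat.centralBinom (k + 1) * sexticCoeff (k + 1))
      = ((k + 1) * Nat.centralBinom (k + 1)) * ((k + 1) ^ 2 * sexticCoeff (k + 1)) := by ring
    _ = _ := by rw [h1, h2]; ring

/-! ### Clausen's formula for formal power series -/

section PowerSeriesIdentity

open PowerSeries

/-- The generating series of `sexticCoeff`. -/
noncomputable def sexticSeries : ℚ⟦X⟧ := PowerSeries.mk fun k => (sexticCoeff k : ℚ)

/-- The generating series of `sexticCubicCoeff`. -/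
noncomputable def sexticCubicSeries : ℚ⟦X⟧ := PowerSeries.mk fun k => (sexticCubicCoeff k : ℚ)

lemma sexticSeries_ode :
    (X - 432 * X ^ 2) * d⁄dX ℚ (d⁄dX ℚ sexticSeries) + (1 - 864 * X) * d⁄dX ℚ sexticSeries
      - 60 * sexticSeries = 0 := by
  have hw : ∀ k, coeff k sexticSeries = (sexticCoeff k : ℚ) := fun k => by
    rw [sexticSeries, coeff_mk]
  generalize sexticSeries = W at *
  have e : (X - 432 * X ^ 2) * d⁄dX ℚ (d⁄dX ℚ W) + (1 - 864 * X) * d⁄dX ℚ W - 60 * W =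
      X ^ 1 * d⁄dX ℚ (d⁄dX ℚ W) - C 432 * (X ^ 2 * d⁄dX ℚ (d⁄dX ℚ W)) +
        d⁄dX ℚ W - C 864 * (X ^ 1 * d⁄dX ℚ W) - C 60 * W := by
    simp only [map_ofNat]
    ring
  rw [e]
  ext n
  have h := congrArg (Nat.cast (R := ℚ)) (sexticCoeff_succ n)
  push_cast at h
  simp only [← hw] at h
  clear hw
  simp only [map_sub, map_add, coeff_C_mul, coeff_X_pow_mul', coeff_derivative, map_zero]
  rcases n with _ | _ | n
  · norm_num at h ⊢
    linear_combination h
  · norm_num at h ⊢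
    linear_combination h
  · norm_num [show n + 1 + 1 - 2 = n from rfl] at h ⊢
    linear_combination h

lemma sexticCubicSeries_ode :
    X ^ 2 * d⁄dX ℚ (d⁄dX ℚ (d⁄dX ℚ sexticCubicSeries)) +
      3 * X * d⁄dX ℚ (d⁄dX ℚ sexticCubicSeries) + d⁄dX ℚ sexticCubicSeries =
    24 * (72 * X ^ 3 * d⁄dX ℚ (d⁄dX ℚ (d⁄dX ℚ sexticCubicSeries)) +
      324 * X ^ 2 * d⁄dX ℚ (d⁄dX ℚ sexticCubicSeries) + 226 * X * d⁄dX ℚ sexticCubicSeries +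
      5 * sexticCubicSeries) := by
  have hw : ∀ k, coeff k sexticCubicSeries = (sexticCubicCoeff k : ℚ) := fun k => by
    rw [sexticCubicSeries, coeff_mk]
  generalize sexticCubicSeries = W at *
  have e : X ^ 2 * d⁄dX ℚ (d⁄dX ℚ (d⁄dX ℚ W)) + C 3 * (X ^ 1 * d⁄dX ℚ (d⁄dX ℚ W)) + d⁄dX ℚ W =
      C 1728 * (X ^ 3 * d⁄dX ℚ (d⁄dX ℚ (d⁄dX ℚ W))) + C 7776 * (X ^ 2 * d⁄dX ℚ (d⁄dX ℚ W)) +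
        C 5424 * (X ^ 1 * d⁄dX ℚ W) + C 120 * W := by
    ext n
    have h := congrArg (Nat.cast (R := ℚ)) (sexticCubicCoeff_succ n)
    push_cast at h
    simp only [← hw] at h
    clear hw
    simp only [map_add, coeff_C_mul, coeff_X_pow_mul', coeff_derivative]
    rcases n with _ | _ | _ | n
    · norm_num at h ⊢
      linear_combination h
    · norm_num at h ⊢
      linear_combination h
    · norm_num at h ⊢
      linear_combination h
    · norm_num [show n + 1 + 1 + 1 - 2 = n + 1 from rfl,
        show n + 1 + 1 + 1 - 3 = n from rfl] at h ⊢
      linear_combination h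
  simp only [map_ofNat] at e
  linear_combination e

/-- The symmetric square of the operator annihilating `sexticSeries`. -/
noncomputable def symSquareOp (W : ℚ⟦X⟧) : ℚ⟦X⟧ :=
  (X - 432 * X ^ 2) ^ 2 * d⁄dX ℚ (d⁄dX ℚ (d⁄dX ℚ W)) +
    3 * (X - 432 * X ^ 2) * (1 - 864 * X) * d⁄dX ℚ (d⁄dX ℚ W) +
    ((1 - 864 * X) ^ 2 - 1104 * (X - 432 * X ^ 2)) * d⁄dX ℚ W - 120 * (1 - 864 * X) * W

lemma powerSeries_derivative_natCast (n : ℕ) : d⁄dX ℚ (n : ℚ⟦X⟧) = 0 := by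
  simp

lemma derivative_quadratic : d⁄dX ℚ (X - 432 * X ^ 2 : ℚ⟦X⟧) = 1 - 864 * X := by
  have h := powerSeries_derivative_natCast 432
  push_cast at h
  simp only [map_sub, Derivation.leibniz, Derivation.leibniz_pow, derivative_X, h, smul_eq_mul,
    nsmul_eq_mul]
  push_cast
  ring

lemma derivative_linear : d⁄dX ℚ (1 - 864 * X : ℚ⟦X⟧) = -864 := by
  have h := powerSeries_derivative_natCast 864
  push_cast at h
  simp only [map_sub, Derivation.leibniz, derivative_X, h, smul_eq_mul, Derivation.map_one_eq_zero]
  ring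

lemma symSquareOp_sq : symSquareOp (sexticSeries ^ 2) = 0 := by
  have h := sexticSeries_ode
  have h60 := powerSeries_derivative_natCast 60
  push_cast at h60
  have h' := congrArg (d⁄dX ℚ) h
  rw [map_sub, map_add, Derivation.leibniz, Derivation.leibniz, Derivation.leibniz,
    derivative_quadratic, derivative_linear, h60, map_zero] at h'
  simp only [smul_eq_mul] at h'
  rw [symSquareOp]
  have d1 : d⁄dX ℚ (sexticSeries ^ 2) = 2 * (sexticSeries * d⁄dX ℚ sexticSeries) := by
    rw [sq, Derivation.leibniz, smul_eq_mul]; ring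
  have h2 : d⁄dX ℚ (2 : ℚ⟦X⟧) = 0 := by exact_mod_cast powerSeries_derivative_natCast 2
  simp only [d1, Derivation.leibniz, map_add, smul_eq_mul, h2, map_zero]
  generalize d⁄dX ℚ (d⁄dX ℚ (d⁄dX ℚ sexticSeries)) = F3 at *
  generalize d⁄dX ℚ (d⁄dX ℚ sexticSeries) = F2 at *
  generalize d⁄dX ℚ sexticSeries = F1 at *
  generalize sexticSeries = F at *
  -- With `P = X - 432X²` and `L F = 0` the equation of `F`, the operator on `F²` is `2PF·(L F)' +
  -- (6PF' + 2P'F)·L F`.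
  linear_combination (2 * (X - 432 * X ^ 2) * F) * h' +
    (6 * (X - 432 * X ^ 2) * F1 + 2 * (1 - 864 * X) * F) * h

lemma hasSubst_quadratic : HasSubst (X - 432 * X ^ 2 : ℚ⟦X⟧) := by
  apply HasSubst.of_constantCoeff_zero'
  simp

/-- The chain rule pulls the equation of the cubic series back along `P = X - 432X²`; as `P'² = 1 -
1728P`, multiplying by `P'` yields exactly the symmetric square. -/
lemma symSquareOp_subst : symSquareOp (sexticCubicSeries.subst (X - 432 * X ^ 2 : ℚ⟦X⟧)) = 0 := by
  have hs := hasSubst_quadratic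
  have h := congrArg (substAlgHom (R := ℚ) hs) sexticCubicSeries_ode
  simp only [map_add, map_mul, map_pow, map_ofNat, substAlgHom_X] at h
  rw [coe_substAlgHom] at h
  have h864 := powerSeries_derivative_natCast 864
  push_cast at h864
  rw [symSquareOp]
  simp only [derivative_subst hs, derivative_quadratic, Derivation.leibniz, map_add, smul_eq_mul,
    derivative_linear, map_neg, h864]
  linear_combination (1 - 864 * X) * h

/-- The `n`-th coefficient of the equation is `(n+1)³ W_{n+1}` plus multiples of earlier
coefficients, so the constant term determines the solution. -/
lemma eq_zero_of_symSquareOp {W : ℚ⟦X⟧} (h : symSquareOp W = 0) (h0 : coeff 0 W = 0) : W = 0 := by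
  have key : ∀ n, (∀ j ≤ n, coeff j W = 0) → coeff (n + 1) W = 0 := by
    intro n hz
    have h1 := congrArg (coeff n) h
    have e : symSquareOp W =
        (d⁄dX ℚ W + C 3 * (X ^ 1 * d⁄dX ℚ (d⁄dX ℚ W)) +
          X ^ 2 * d⁄dX ℚ (d⁄dX ℚ (d⁄dX ℚ W))) -
        C 864 * (X ^ 3 * d⁄dX ℚ (d⁄dX ℚ (d⁄dX ℚ W))) +
        C 186624 * (X ^ 4 * d⁄dX ℚ (d⁄dX ℚ (d⁄dX ℚ W))) -
        C 3888 * (X ^ 2 * d⁄dX ℚ (d⁄dX ℚ W)) +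
        C 1119744 * (X ^ 3 * d⁄dX ℚ (d⁄dX ℚ W)) -
        C 2832 * (X ^ 1 * d⁄dX ℚ W) +
        C 1223424 * (X ^ 2 * d⁄dX ℚ W) - C 120 * W +
          C 103680 * (X ^ 1 * W) := by
      rw [symSquareOp]
      simp only [map_ofNat]
      ring
    rw [e] at h1
    simp only [map_sub, map_add, coeff_C_mul, coeff_X_pow_mul', coeff_derivative, map_zero] at h1
    rcases n with _ | _ | _ | _ | n
    · norm_num [hz] at h1 ⊢
      linarith
    · norm_num [hz] at h1 ⊢
      linarith
    · norm_num [hz] at h1 ⊢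
      linarith
    · norm_num [hz] at h1 ⊢
      linarith
    · rw [show n + 1 + 1 + 1 + 1 - 1 = n + 3 from rfl, show n + 1 + 1 + 1 + 1 - 2 = n + 2 from rfl,
        show n + 1 + 1 + 1 + 1 - 3 = n + 1 from rfl, show n + 1 + 1 + 1 + 1 - 4 = n from rfl] at h1
      simp only [Nat.add_assoc, Nat.reduceAdd] at h1 hz ⊢
      rw [hz (n + 3) (by omega), hz (n + 4) le_rfl] at h1
      have hne : ((n : ℚ) + 5) ^ 3 ≠ 0 := by positivity
      apply (mul_eq_zero.mp _).resolve_left hne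
      push_cast at h1
      linear_combination h1
  ext n
  induction n using Nat.strong_induction_on with
  | _ n ih =>
    rcases n with _ | n
    · simpa using h0
    · rw [key n fun j hj => by simpa using ih j (by omega), map_zero]

lemma coeff_quadratic_pow {m k : ℕ} (h : m < k) :
    coeff m ((X - 432 * X ^ 2 : ℚ⟦X⟧) ^ k) = 0 := by
  rw [show (X - 432 * X ^ 2 : ℚ⟦X⟧) = X * (1 - 432 * X) by ring, mul_pow, coeff_X_pow_mul',
    if_neg (by omega)]

lemma coeff_sexticCubicSeries_subst {m N : ℕ} (h : m < N) :
    coeff m (sexticCubicSeries.subst (X - 432 * X ^ 2 : ℚ⟦X⟧)) =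
      ∑ k ∈ Finset.range N,
        (sexticCubicCoeff k : ℚ) * coeff m ((X - 432 * X ^ 2 : ℚ⟦X⟧) ^ k) := by
  rw [coeff_subst' hasSubst_quadratic, finsum_eq_sum_of_support_subset (s := Finset.range N)]
  · simp only [sexticCubicSeries, coeff_mk, smul_eq_mul]
  · intro k hk
    by_contra hk'
    apply hk
    simp only [Finset.coe_range, Set.mem_Iio, not_lt] at hk'
    simp only [coeff_quadratic_pow (h.trans_le hk'), smul_zero]

/-- Clausen's formula for the parameters `1/6, 5/6`. -/
theorem sexticSeries_sq :
    sexticSeries ^ 2 = sexticCubicSeries.subst (X - 432 * X ^ 2 : ℚ⟦X⟧) := by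
  rw [← sub_eq_zero]
  apply eq_zero_of_symSquareOp
  · have h1 := symSquareOp_sq
    have h2 := symSquareOp_subst
    rw [symSquareOp] at h1 h2 ⊢
    simp only [map_sub]
    linear_combination h1 - h2
  · rw [map_sub, coeff_sexticCubicSeries_subst zero_lt_one]
    simp [sexticSeries, sexticCoeff, sexticCubicCoeff]

end PowerSeriesIdentity

/-! ### Divisibility of the coefficients by `p` and `p²` -/

lemma dvd_sexticCoeff_succ {p e k : ℕ} [hp : Fact p.Prime] (hk : k + 1 < p)
    (h : p ^ e ∣ (6 * k + 1) * (6 * k + 5) * sexticCoeff k) : p ^ e ∣ sexticCoeff (k + 1) := by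
  have hcop : Nat.Coprime (p ^ e) ((k + 1) ^ 2) :=
    Nat.Coprime.pow _ _ (hp.out.coprime_iff_not_dvd.mpr fun hd =>
      absurd (Nat.le_of_dvd k.succ_pos hd) (by omega))
  apply hcop.dvd_of_dvd_mul_left
  rw [sexticCoeff_succ, mul_assoc]
  exact h.mul_left 12

lemma dvd_sexticCoeff_of_le {p e j : ℕ} [Fact p.Prime] (h : p ^ e ∣ sexticCoeff j) {k : ℕ}
    (hjk : j ≤ k) (hk : k < p) : p ^ e ∣ sexticCoeff k := by
  induction k, hjk using Nat.le_induction with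
  | base => exact h
  | succ k _ ih => exact dvd_sexticCoeff_succ hk ((ih (by omega)).mul_left _)

lemma prime_mod_six {p : ℕ} (h : p.Prime) (hp : 3 < p) : p % 6 = 1 ∨ p % 6 = 5 := by
  have h2 : ¬ 2 ∣ p := fun hd => by
    have := (Nat.prime_dvd_prime_iff_eq Nat.prime_two h).mp hd; omega
  have h3 : ¬ 3 ∣ p := fun hd => by
    have := (Nat.prime_dvd_prime_iff_eq Nat.prime_three h).mp hd; omega
  omega

lemma prime_dvd_sexticCoeff {p k : ℕ} [hp : Fact p.Prime] (h3 : 3 < p) (h : p / 6 < k)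
    (hk : k < p) : p ∣ sexticCoeff k := by
  have h1 : p ^ 1 ∣ sexticCoeff (p / 6 + 1) := by
    apply dvd_sexticCoeff_succ (by omega)
    rw [pow_one]
    apply Dvd.dvd.mul_right
    -- At `k = p / 6`, either `6k + 1 = p` or `6k + 5 = p`.
    rcases prime_mod_six hp.out h3 with h | h
    · exact Dvd.dvd.mul_right (Dvd.intro 1 (by omega)) _
    · exact Dvd.dvd.mul_left (Dvd.intro 1 (by omega)) _
  simpa using dvd_sexticCoeff_of_le h1 h hk

lemma prime_sq_dvd_sexticCoeff {p k : ℕ} [hp : Fact p.Prime] (h3 : 3 < p) (h : p ≤ k + p / 6)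
    (hk : k < p) : p ^ 2 ∣ sexticCoeff k := by
  have h1 : p ^ 2 ∣ sexticCoeff ((p - p / 6 - 1) + 1) := by
    apply dvd_sexticCoeff_succ (by omega)
    rw [sq]
    apply mul_dvd_mul _ (prime_dvd_sexticCoeff h3 (by omega) (by omega))
    -- At `k = p - p/6 - 1`, either `6k + 5 = 5p` or `6k + 1 = 5p`: a second factor `p` enters.
    rcases prime_mod_six hp.out h3 with h | h
    · exact Dvd.dvd.mul_left (Dvd.intro 5 (by omega)) _
    · exact Dvd.dvd.mul_right (Dvd.intro 5 (by omega)) _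
  exact dvd_sexticCoeff_of_le h1 (by omega) hk

/-- Either both indices exceed `p / 6` and each factor supplies one `p`, or one does not and the
other is at least `p - p/6`, supplying `p²` alone. -/
lemma prime_sq_dvd_sexticCoeff_mul {p i j : ℕ} [Fact p.Prime] (h3 : 3 < p) (hi : i < p)
    (hj : j < p) (hij : p ≤ i + j) : p ^ 2 ∣ sexticCoeff i * sexticCoeff j := by
  by_cases h1 : i ≤ p / 6
  · exact (prime_sq_dvd_sexticCoeff h3 (by omega) hj).mul_left _
  by_cases h2 : j ≤ p / 6
  · exact (prime_sq_dvd_sexticCoeff h3 (by omega) hi).mul_right _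
  rw [sq]
  exact mul_dvd_mul (prime_dvd_sexticCoeff h3 (by omega) hi)
    (prime_dvd_sexticCoeff h3 (by omega) hj)

lemma prime_dvd_centralBinom {p k : ℕ} [hp : Fact p.Prime] (h : p ≤ 2 * k) (hk : k < p) :
    p ∣ Nat.centralBinom k := by
  rw [Nat.centralBinom]
  exact hp.out.dvd_choose hk (by omega) h

lemma prime_sq_dvd_sexticCubicCoeff {p k : ℕ} [Fact p.Prime] (h3 : 3 < p) (h : p ≤ 2 * k)
    (hk : k < p) : p ^ 2 ∣ sexticCubicCoeff k := by
  rw [sexticCubicCoeff_eq, sq]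
  exact mul_dvd_mul (prime_dvd_centralBinom h hk) (prime_dvd_sexticCoeff h3 (by omega) hk)

lemma prime_dvd_sexticCubicCoeff {p k : ℕ} [Fact p.Prime] (h3 : 3 < p) (h : p / 6 < k)
    (hk : k < p) : p ∣ sexticCubicCoeff k := by
  rw [sexticCubicCoeff_eq]
  exact (prime_dvd_sexticCoeff h3 h hk).mul_left _

/-! ### Truncation of Clausen's formula modulo `p²` -/

section PolynomialCongruence

open Polynomial

lemma coeff_trunc_sextic_sq (N m : ℕ) :
    ((∑ k ∈ Finset.range N, C (sexticCoeff k : ℤ) * X ^ k) ^ 2).coeff m =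
      ∑ ij ∈ Finset.HasAntidiagonal.antidiagonal m,
        (if ij.1 < N then (sexticCoeff ij.1 : ℤ) else 0) *
          (if ij.2 < N then (sexticCoeff ij.2 : ℤ) else 0) := by
  have h : ∀ i, (∑ k ∈ Finset.range N, C (sexticCoeff k : ℤ) * X ^ k).coeff i =
      if i < N then (sexticCoeff i : ℤ) else 0 := by
    intro i
    simp [finsetSum_coeff, coeff_X_pow]
  rw [sq, coeff_mul]
  simp only [h]

lemma coeff_trunc_sexticCubic (N m : ℕ) :
    (∑ k ∈ Finset.range N, C (sexticCubicCoeff k : ℤ) * (X - 432 * X ^ 2) ^ k).coeff m =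
      ∑ k ∈ Finset.range N, (sexticCubicCoeff k : ℤ) * ((X - 432 * X ^ 2 : ℤ[X]) ^ k).coeff m := by
  simp only [finsetSum_coeff, coeff_C_mul]

lemma coeff_trunc_eq {N m : ℕ} (h : m < N) :
    ((∑ k ∈ Finset.range N, C (sexticCoeff k : ℤ) * X ^ k) ^ 2).coeff m =
      (∑ k ∈ Finset.range N, C (sexticCubicCoeff k : ℤ) * (X - 432 * X ^ 2) ^ k).coeff m := by
  rw [coeff_trunc_sextic_sq, coeff_trunc_sexticCubic]
  have key := congrArg (PowerSeries.coeff m) sexticSeries_sq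
  rw [coeff_sexticCubicSeries_subst h, sq, PowerSeries.coeff_mul] at key
  simp only [sexticSeries, PowerSeries.coeff_mk] at key
  have hc : ∀ k, PowerSeries.coeff m
      ((PowerSeries.X - 432 * PowerSeries.X ^ 2 : PowerSeries ℚ) ^ k) =
      ((((X - 432 * X ^ 2 : ℤ[X]) ^ k).coeff m : ℤ) : ℚ) := by
    intro k
    have : ((PowerSeries.X - 432 * PowerSeries.X ^ 2 : PowerSeries ℚ) ^ k) =
        ((((X - 432 * X ^ 2 : ℤ[X]) ^ k).map (Int.castRingHom ℚ) : ℚ[X]) : PowerSeries ℚ) := by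
      have h432 : ((432 : ℚ[X]) : PowerSeries ℚ) = 432 :=
        map_ofNat (Polynomial.coeToPowerSeries.ringHom (R := ℚ)) 432
      simp [h432]
    rw [this, Polynomial.coeff_coe, coeff_map, eq_intCast]
  simp only [hc] at key
  have : ∑ ij ∈ Finset.HasAntidiagonal.antidiagonal m,
        (if ij.1 < N then (sexticCoeff ij.1 : ℤ) else 0) *
          (if ij.2 < N then (sexticCoeff ij.2 : ℤ) else 0) =
      ∑ ij ∈ Finset.HasAntidiagonal.antidiagonal m, (sexticCoeff ij.1 : ℤ) * (sexticCoeff ij.2 : ℤ) := by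
    apply Finset.sum_congr rfl
    intro ij hij
    rw [Finset.HasAntidiagonal.mem_antidiagonal] at hij
    rw [if_pos (by omega), if_pos (by omega)]
  rw [this]
  exact_mod_cast key

/-- The truncated form of Clausen's formula, modulo `p²`. -/
theorem prime_sq_dvd_clausen {p : ℕ} [Fact p.Prime] (h3 : 3 < p) :
    C ((p : ℤ) ^ 2) ∣ (∑ k ∈ Finset.range p, C (sexticCoeff k : ℤ) * X ^ k) ^ 2 -
      ∑ k ∈ Finset.range p, C (sexticCubicCoeff k : ℤ) * (X - 432 * X ^ 2) ^ k := by
  rw [C_dvd_iff_dvd_coeff]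
  intro m
  rw [coeff_sub]
  -- Below degree `p` truncation changes nothing; from degree `p` on, both sides vanish modulo `p²`
  -- separately.
  rcases lt_or_ge m p with h | h
  · rw [coeff_trunc_eq h, sub_self]
    exact dvd_zero _
  apply dvd_sub
  · rw [coeff_trunc_sextic_sq]
    apply Finset.dvd_sum
    intro ij hij
    rw [Finset.HasAntidiagonal.mem_antidiagonal] at hij
    split_ifs with h1 h2
    · exact_mod_cast prime_sq_dvd_sexticCoeff_mul h3 h1 h2 (by omega)
    all_goals simp
  · rw [coeff_trunc_sexticCubic]
    apply Finset.dvd_sum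
    intro k hk
    rw [Finset.mem_range] at hk
    -- The `k`-th term has degree at most `2k`, so only `2k ≥ p` reaches degree `m ≥ p`.
    by_cases h2 : p ≤ 2 * k
    · apply Dvd.dvd.mul_right
      exact_mod_cast prime_sq_dvd_sexticCubicCoeff h3 h2 hk
    · rw [coeff_eq_zero_of_natDegree_lt, mul_zero]
      · exact dvd_zero _
      · have hd : (X - 432 * X ^ 2 : ℤ[X]).natDegree ≤ 2 := by compute_degree
        have := natDegree_pow_le_of_le k hd
        omega

/-- Clausen's formula for the truncated series at a point of a ring of characteristic
dividing `p²`. -/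
theorem sum_sexticCoeff_sq {p : ℕ} [Fact p.Prime] (h3 : 3 < p) {O : Type*} [CommRing O]
    (hO : (p : O) ^ 2 = 0) (x : O) :
    (∑ k ∈ Finset.range p, (sexticCoeff k : O) * x ^ k) ^ 2 =
      ∑ k ∈ Finset.range p, (sexticCubicCoeff k : O) * (x - 432 * x ^ 2) ^ k := by
  obtain ⟨Q, hQ⟩ := prime_sq_dvd_clausen (p := p) h3
  have h := congrArg (aeval x) hQ
  simp only [map_sub, map_pow, map_sum, map_mul, aeval_X, map_ofNat, map_natCast, hO, zero_mul] at h
  exact sub_eq_zero.mp h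

end PolynomialCongruence

/-! ### The character sum as a truncated hypergeometric sum -/

section CharacterSum

open Polynomial

/-- The nodal cubic `(X - 1)²(X + 2)`. -/
noncomputable def nodalCubic (R : Type*) [CommRing R] : R[X] := X ^ 3 - 3 * X + 2

/-- Relates consecutive powers of `G = (X-1)²(X+2)` modulo exact derivatives. The factor
`(X-1)(X+2)` is there because `(X-1)(X+2)G' = 3(X+1)G`, which keeps the power `G^i` after
differentiation. -/
lemma derivative_nodalCubic_pow (R : Type*) [CommRing R] (i : ℕ) :
    derivative ((X - 1) * (X + 2) *
        ((3 * ((i : R[X]) + 1) - 1) * (X ^ 2 - X) - 6 * ((i : R[X]) + 1)) * nodalCubic R ^ i) =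
      (9 * ((i : R[X]) + 1) ^ 2 - 1) * nodalCubic R ^ (i + 1) -
        18 * ((i : R[X]) + 1) * (2 * (i : R[X]) + 1) * nodalCubic R ^ i := by
  have hG : derivative (nodalCubic R) = 3 * (X ^ 2 - 1) := by
    simp [nodalCubic, map_ofNat]
    ring
  have hq : derivative ((X - 1) * (X + 2) *
        ((3 * ((i : R[X]) + 1) - 1) * (X ^ 2 - X) - 6 * ((i : R[X]) + 1))) =
      (2 * X + 1) * ((3 * ((i : R[X]) + 1) - 1) * (X ^ 2 - X) - 6 * ((i : R[X]) + 1)) +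
      (X - 1) * (X + 2) * ((3 * ((i : R[X]) + 1) - 1) * (2 * X - 1)) := by
    simp
    ring
  rw [derivative_mul, hq, derivative_pow, hG]
  rcases i with _ | i
  · simp [nodalCubic]
    ring
  · simp only [Nat.add_sub_cancel, C_eq_natCast, pow_succ (nodalCubic R)]
    generalize hg : nodalCubic R ^ i = g
    simp only [nodalCubic]
    push_cast
    ring

/-- In characteristic `p` a derivative has no `X^(p-1)` term, so the exact derivative drops out. -/
lemma coeff_nodalCubic_pow_succ (p : ℕ) [hp : Fact p.Prime] (i : ℕ) :
    (9 * ((i : ZMod p) + 1) ^ 2 - 1) * (nodalCubic (ZMod p) ^ (i + 1)).coeff (p - 1) =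
      18 * ((i : ZMod p) + 1) * (2 * (i : ZMod p) + 1) *
        (nodalCubic (ZMod p) ^ i).coeff (p - 1) := by
  have h := congrArg (fun P => coeff P (p - 1)) (derivative_nodalCubic_pow (ZMod p) i)
  have e1 : (9 * ((i : (ZMod p)[X]) + 1) ^ 2 - 1) = C (9 * ((i : ZMod p) + 1) ^ 2 - 1) := by
    simp [map_ofNat]
  have e2 : 18 * ((i : (ZMod p)[X]) + 1) * (2 * (i : (ZMod p)[X]) + 1) =
      C (18 * ((i : ZMod p) + 1) * (2 * (i : ZMod p) + 1)) := by
    simp [map_ofNat]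
  have hpp : ((p - 1 : ℕ) : ZMod p) + 1 = 0 := by
    have : ((p - 1 + 1 : ℕ) : ZMod p) = 0 := by
      rw [Nat.sub_add_cancel hp.out.one_le, CharP.cast_eq_zero]
    exact_mod_cast this
  beta_reduce at h
  rw [coeff_derivative, hpp, mul_zero, e1, e2, coeff_sub, coeff_C_mul, coeff_C_mul] at h
  linear_combination -h

lemma two_mul_half_add_one (p : ℕ) [hp : Fact p.Prime] (h3 : 3 < p) : 2 * (p / 2) + 1 = p := by
  rcases prime_mod_six hp.out h3 with h | h <;> omega

lemma choose_mul_coeff_nodalCubic_pow (p : ℕ) [hp : Fact p.Prime] (h3 : 3 < p) {k : ℕ}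
    (hk : k ≤ p / 2) :
    ((p / 2).choose k : ZMod p) * (-1728) ^ k *
        (nodalCubic (ZMod p) ^ (p / 2 - k)).coeff (p - 1) =
      (nodalCubic (ZMod p) ^ (p / 2)).coeff (p - 1) * (sexticCoeff k : ZMod p) := by
  induction k with
  | zero => simp [sexticCoeff]
  | succ k ih =>
    obtain ⟨i, hi⟩ : ∃ i, p / 2 = k + 1 + i := Nat.exists_eq_add_of_le hk
    have ih := ih (by omega)
    have hrec := coeff_nodalCubic_pow_succ p i
    have hchoose : (((p / 2).choose (k + 1) * (k + 1) : ℕ) : ZMod p) =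
        ((p / 2).choose k * (i + 1) : ℕ) := by
      rw [Nat.choose_succ_right_eq]
      congr 2
      omega
    have hc := congrArg (Nat.cast (R := ZMod p)) (sexticCoeff_succ k)
    have hp2 : (2 * ((k : ZMod p) + 1 + i) + 1) = 0 := by
      have h0 : ((2 * (p / 2) + 1 : ℕ) : ZMod p) = 0 := by
        rw [two_mul_half_add_one p h3, CharP.cast_eq_zero]
      rw [hi] at h0
      exact_mod_cast h0
    have hk0 : ((k : ZMod p) + 1) ≠ 0 := by
      have : ((k + 1 : ℕ) : ZMod p) ≠ 0 := by
        rw [Ne, ZMod.natCast_eq_zero_iff]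
        exact fun hd => absurd (Nat.le_of_dvd k.succ_pos hd) (by omega)
      exact_mod_cast this
    push_cast at hchoose hc
    rw [show p / 2 - (k + 1) = i by omega]
    rw [show p / 2 - k = i + 1 by omega] at ih
    generalize (nodalCubic (ZMod p) ^ (p / 2)).coeff (p - 1) = eh at *
    generalize (nodalCubic (ZMod p) ^ (i + 1)).coeff (p - 1) = e1 at *
    generalize (nodalCubic (ZMod p) ^ i).coeff (p - 1) = e0 at *
    apply mul_left_cancel₀ (pow_ne_zero 2 hk0)
    calc ((k : ZMod p) + 1) ^ 2 * (((p / 2).choose (k + 1) : ZMod p) * (-1728) ^ (k + 1) * e0)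
        = ((k : ZMod p) + 1) * (((p / 2).choose (k + 1) : ZMod p) * (k + 1)) *
            (-1728) ^ (k + 1) * e0 := by ring
      _ = ((p / 2).choose k : ZMod p) * (-1728) ^ k *
            (-1728 * ((k : ZMod p) + 1) * (i + 1) * e0) := by rw [hchoose]; ring
      _ = ((p / 2).choose k : ZMod p) * (-1728) ^ k *
            (12 * ((6 * k + 1) * (6 * k + 5)) * e1) := by
          congr 1
          -- Modulo `p`, `2(i+1) = -(2k+1)`; hence `4(9(i+1)² - 1) = (6k+1)(6k+5)` and `2i+1 =
          -- -2(k+1)`, which turns the recurrence in the exponent into that of `sexticCoeff`.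
          linear_combination (-864 * ((i : ZMod p) + 1) * e0 -
            108 * (2 * (k : ZMod p) + 1 - 2 * (i + 1)) * e1) * hp2 - 48 * hrec
      _ = 12 * ((6 * k + 1) * (6 * k + 5)) * (eh * (sexticCoeff k : ZMod p)) := by
          rw [← ih]; ring
      _ = ((k : ZMod p) + 1) ^ 2 * (eh * (sexticCoeff (k + 1) : ZMod p)) := by
          linear_combination -eh * hc

lemma natCast_eq_zero_of_dvd {p : ℕ} [Fact p.Prime] (O : Type*) [CommRing O] [Algebra (ZMod p) O]
    {a : ℕ} (h : p ∣ a) : (a : O) = 0 := by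
  rw [← map_natCast (algebraMap (ZMod p) O), (ZMod.natCast_eq_zero_iff a p).mpr h, map_zero]

lemma coeff_nodalCubic_sub_pow {p : ℕ} [hp : Fact p.Prime] (h3 : 3 < p) {O : Type*} [CommRing O]
    [Algebra (ZMod p) O] (x : O) :
    ((nodalCubic O + C (-1728 * x)) ^ (p / 2)).coeff (p - 1) =
      algebraMap (ZMod p) O ((nodalCubic (ZMod p) ^ (p / 2)).coeff (p - 1)) *
        ∑ k ∈ Finset.range p, (sexticCoeff k : O) * x ^ k := by
  have hsub : ∑ k ∈ Finset.range p, (sexticCoeff k : O) * x ^ k =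
      ∑ k ∈ Finset.range (p / 2 + 1), (sexticCoeff k : O) * x ^ k := by
    symm
    apply Finset.sum_subset
    · intro k hk
      simp only [Finset.mem_range] at hk ⊢
      omega
    · intro k hk hk'
      simp only [Finset.mem_range] at hk hk'
      rw [natCast_eq_zero_of_dvd O (prime_dvd_sexticCoeff h3 (by omega) hk), zero_mul]
  have hcoeff : ∀ j, (nodalCubic O ^ j).coeff (p - 1) =
      algebraMap (ZMod p) O ((nodalCubic (ZMod p) ^ j).coeff (p - 1)) := by
    intro j
    rw [← coeff_map]
    simp [nodalCubic]
  rw [hsub, add_comm, add_pow, finsetSum_coeff, Finset.mul_sum]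
  apply Finset.sum_congr rfl
  intro k hk
  rw [Finset.mem_range] at hk
  have h := congrArg (algebraMap (ZMod p) O)
    (choose_mul_coeff_nodalCubic_pow p h3 (show k ≤ p / 2 by omega))
  simp only [map_mul, map_pow, map_neg, map_ofNat, map_natCast] at h
  rw [← C_eq_natCast, ← C_pow, coeff_mul_C, coeff_C_mul, hcoeff, mul_pow]
  linear_combination x ^ k * h

lemma coeff_cubic_pow {p : ℕ} [hp : Fact p.Prime] (h3 : 3 < p) {O : Type*} [CommRing O]
    [Algebra (ZMod p) O] {m n u x : O} (hu : IsUnit u) (hm : m = -3 * u ^ 2)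
    (hn : n = 2 * u ^ 3 * (1 - 864 * x)) :
    ((X ^ 3 + C m * X + C n) ^ (p / 2)).coeff (p - 1) =
      u ^ (p / 2) * (algebraMap (ZMod p) O ((nodalCubic (ZMod p) ^ (p / 2)).coeff (p - 1)) *
        ∑ k ∈ Finset.range p, (sexticCoeff k : O) * x ^ k) := by
  rw [← coeff_nodalCubic_sub_pow h3]
  have hcomp : ((X ^ 3 + C m * X + C n) ^ (p / 2)).comp (C u * X) =
      C (u ^ 3) ^ (p / 2) * (nodalCubic O + C (-1728 * x)) ^ (p / 2) := by
    rw [← mul_pow, pow_comp, hm, hn]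
    congr 1
    simp [nodalCubic, map_ofNat]
    ring
  have h := congrArg (fun P => coeff P (p - 1)) hcomp
  simp only [comp_C_mul_X_coeff] at h
  rw [← C_pow, coeff_C_mul] at h
  have h2 := two_mul_half_add_one p h3
  have hp1 : p - 1 = 2 * (p / 2) := by omega
  -- Scaling `X` by `u` multiplies this coefficient by `u^(p-1)`, against `u^(3(p-1)/2)` from the
  -- cubic; `u^((p-1)/2)` remains.
  apply (hu.pow (p - 1)).mul_right_cancel
  rw [h]
  nth_rewrite 3 [hp1]
  ring

lemma sum_pow_card_sub_one_eq {p : ℕ} [hp : Fact p.Prime] {i : ℕ} (hi : i < 2 * (p - 1)) :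
    ∑ y : ZMod p, y ^ i = if i = p - 1 then -1 else 0 := by
  have h2 := hp.out.two_le
  have hcard : Fintype.card (ZMod p) = p := ZMod.card p
  rcases lt_trichotomy i (p - 1) with h | h | h
  · rw [if_neg (by omega)]
    exact FiniteField.sum_pow_lt_card_sub_one _ _ (by rw [hcard]; exact h)
  · rw [if_pos h, h, ← Finset.sum_erase_add _ _ (Finset.mem_univ (0 : ZMod p)),
      zero_pow (by omega), add_zero,
      Finset.sum_congr rfl (g := fun _ => (1 : ZMod p)) fun y hy =>
        ZMod.pow_card_sub_one_eq_one (Finset.ne_of_mem_erase hy)]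
    rw [Finset.sum_const, Finset.card_erase_of_mem (Finset.mem_univ _), Finset.card_univ, hcard,
      nsmul_eq_mul, mul_one, Nat.cast_sub (by omega)]
    simp
  · rw [if_neg (by omega)]
    rw [← FiniteField.sum_pow_lt_card_sub_one (ZMod p) (i - (p - 1)) (by rw [hcard]; omega)]
    apply Finset.sum_congr rfl
    intro y _
    rcases eq_or_ne y 0 with rfl | hy
    · rw [zero_pow (by omega), zero_pow (by omega)]
    · obtain ⟨j, rfl⟩ := Nat.exists_eq_add_of_le h.le
      rw [pow_add, ZMod.pow_card_sub_one_eq_one hy, one_mul, Nat.add_sub_cancel_left]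

/-- Power sums over `ZMod p` detect positive multiples of `p - 1`; the degree bound leaves only `p -
1` itself. -/
lemma sum_eval_eq_neg_coeff {p : ℕ} [hp : Fact p.Prime] {P : (ZMod p)[X]}
    (hP : P.natDegree < 2 * (p - 1)) : ∑ y : ZMod p, P.eval y = -P.coeff (p - 1) := by
  have h2 := hp.out.two_le
  simp only [eval_eq_sum_range' hP]
  rw [Finset.sum_comm]
  simp only [← Finset.mul_sum]
  rw [Finset.sum_congr rfl fun i hi => by
    rw [sum_pow_card_sub_one_eq (Finset.mem_range.mp hi)]]
  simp only [mul_ite, mul_neg, mul_one, mul_zero, Finset.sum_ite_eq', Finset.mem_range]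
  rw [if_pos (by omega)]

lemma ringChar_zmod_ne_two {p : ℕ} (h3 : 3 < p) : ringChar (ZMod p) ≠ 2 := by
  rw [ZMod.ringChar_zmod_n]; omega

lemma sum_quadraticChar_eq_neg_coeff {p : ℕ} [hp : Fact p.Prime] (h3 : 3 < p) {P : (ZMod p)[X]}
    (hP : P.natDegree ≤ 3) :
    ((∑ y : ZMod p, quadraticChar (ZMod p) (P.eval y) : ℤ) : ZMod p) =
      -(P ^ (p / 2)).coeff (p - 1) := by
  rw [← sum_eval_eq_neg_coeff]
  · push_cast
    apply Finset.sum_congr rfl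
    intro y _
    rw [quadraticChar_eq_pow_of_char_ne_two' (ringChar_zmod_ne_two h3), ZMod.card, eval_pow]
  · have := natDegree_pow_le_of_le (p / 2) hP
    have := two_mul_half_add_one p h3
    omega

/-- The square factor of `(y-1)²(y+2)` is invisible to the character except at `y = 1`, so the
character sum is that of `y + 2`, which is zero, minus the missing value `(3/p)`. -/
lemma coeff_nodalCubic_pow_half {p : ℕ} [hp : Fact p.Prime] (h3 : 3 < p) :
    (nodalCubic (ZMod p) ^ (p / 2)).coeff (p - 1) = ((quadraticChar (ZMod p) 3 : ℤ) : ZMod p) := by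
  have hd : (nodalCubic (ZMod p)).natDegree ≤ 3 := by
    rw [nodalCubic]; compute_degree
  have hc := sum_quadraticChar_eq_neg_coeff h3 hd
  have hsum : ∑ y : ZMod p, quadraticChar (ZMod p) (y + 2) = 0 := by
    rw [← quadraticChar_sum_zero (ringChar_zmod_ne_two h3)]
    exact Equiv.sum_comp (Equiv.addRight (2 : ZMod p)) fun y => quadraticChar (ZMod p) y
  have hterm : ∀ y : ZMod p, quadraticChar (ZMod p) ((nodalCubic (ZMod p)).eval y) =
      quadraticChar (ZMod p) (y + 2) - if y = 1 then quadraticChar (ZMod p) 3 else 0 := by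
    intro y
    have he : (nodalCubic (ZMod p)).eval y = (y - 1) ^ 2 * (y + 2) := by
      simp [nodalCubic]
      ring
    rw [he]
    split_ifs with hy
    · rw [hy]
      norm_num
    · rw [map_mul, map_pow, quadraticChar_sq_one (sub_ne_zero.mpr hy), one_mul, sub_zero]
  rw [Finset.sum_congr rfl fun y _ => hterm y, Finset.sum_sub_distrib, hsum, zero_sub,
    Finset.sum_ite_eq' , if_pos (Finset.mem_univ _), Int.cast_neg, neg_inj] at hc
  exact hc.symm

/-- The character sum of `x³ + m x + n`, in a ring of characteristic `p` in which `m = -3u²`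
and `n = 2u³(1 - 864 x)`. -/
theorem sum_quadraticChar_cubic {p : ℕ} [hp : Fact p.Prime] (h3 : 3 < p) {O : Type*} [CommRing O]
    [Algebra (ZMod p) O] {m n : ZMod p} {u x : O} (hu : IsUnit u)
    (hm : algebraMap (ZMod p) O m = -3 * u ^ 2)
    (hn : algebraMap (ZMod p) O n = 2 * u ^ 3 * (1 - 864 * x)) :
    ((∑ y : ZMod p, quadraticChar (ZMod p) (y ^ 3 + m * y + n) : ℤ) : O) =
      -(u ^ (p / 2) * ((quadraticChar (ZMod p) 3 : ℤ) *
        ∑ k ∈ Finset.range p, (sexticCoeff k : O) * x ^ k)) := by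
  have hd : (X ^ 3 + C m * X + C n).natDegree ≤ 3 := by compute_degree
  have h := sum_quadraticChar_eq_neg_coeff h3 hd
  have hmap : algebraMap (ZMod p) O (((X ^ 3 + C m * X + C n) ^ (p / 2)).coeff (p - 1)) =
      ((X ^ 3 + C (algebraMap (ZMod p) O m) * X + C (algebraMap (ZMod p) O n)) ^ (p / 2)).coeff
        (p - 1) := by
    rw [← coeff_map]
    simp
  have h' := congrArg (algebraMap (ZMod p) O) h
  rw [map_neg, hmap, coeff_cubic_pow h3 hu hm hn, coeff_nodalCubic_pow_half h3, map_intCast,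
    map_intCast] at h'
  simpa using h'

end CharacterSum

/-! ### The congruences for integers, over a quadratic extension of `ℤ/p²` -/

lemma exists_quadratic_extension (p : ℕ) [hp : Fact p.Prime] (h3 : 3 < p) (m : ℤ) :
    ∃ (O : Type) (_ : CommRing O) (u : O), 3 * u ^ 2 = -(m : O) ∧
      ∀ k : ℤ, (k : O) = 0 ↔ (p : ℤ) ^ 2 ∣ k := by
  have hp1 : Fact (1 < p ^ 2) := ⟨Nat.one_lt_pow two_ne_zero hp.out.one_lt⟩
  set a : ZMod (p ^ 2) := -(m : ZMod (p ^ 2)) * (3 : ZMod (p ^ 2))⁻¹ with ha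
  set f : Polynomial (ZMod (p ^ 2)) := Polynomial.X ^ 2 - Polynomial.C a with hf
  have hmonic : f.Monic := Polynomial.monic_X_pow_sub_C a two_ne_zero
  have hdeg : f.degree = 2 := Polynomial.degree_X_pow_sub_C two_pos a
  refine ⟨AdjoinRoot f, inferInstance, AdjoinRoot.root f, ?_, fun k => ?_⟩
  · have hr : AdjoinRoot.root f ^ 2 = AdjoinRoot.of f a := by
      have := AdjoinRoot.eval₂_root f
      rw [hf] at this
      simp only [Polynomial.eval₂_sub, Polynomial.eval₂_pow, Polynomial.eval₂_X,
        Polynomial.eval₂_C] at this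
      exact sub_eq_zero.mp this
    have h3' : (3 : ZMod (p ^ 2)) * (3 : ZMod (p ^ 2))⁻¹ = 1 := by
      have hc : Nat.Coprime 3 (p ^ 2) := by
        apply Nat.Coprime.pow_right
        rw [Nat.coprime_primes Nat.prime_three hp.out]
        omega
      exact_mod_cast ZMod.coe_mul_inv_eq_one 3 hc
    have h3a : 3 * a = -(m : ZMod (p ^ 2)) := by
      rw [ha]
      linear_combination -(m : ZMod (p ^ 2)) * h3'
    rw [hr, ← map_ofNat (AdjoinRoot.of f) 3, ← map_mul, h3a, map_neg, map_intCast]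
  · rw [← map_intCast (AdjoinRoot.of f), ← AdjoinRoot.mk_C, AdjoinRoot.mk_eq_zero]
    have h0 : (k : ZMod (p ^ 2)) = 0 ↔ (p : ℤ) ^ 2 ∣ k := by
      rw [ZMod.intCast_zmod_eq_zero_iff_dvd, Nat.cast_pow]
    rw [← h0]
    constructor
    · intro hd
      by_contra hk
      -- A nonzero constant is not a multiple of the monic quadratic, so `ℤ/p²` embeds.
      exact hmonic.not_dvd_of_degree_lt (Polynomial.C_ne_zero.mpr hk)
        (by rw [hdeg]; exact Polynomial.degree_C_le.trans_lt (by norm_num)) hd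
    · intro hk
      rw [hk, Polynomial.C_0]
      exact dvd_zero _

lemma isUnit_intCast_of_not_dvd {p : ℕ} [hp : Fact p.Prime] {O : Type*} [CommRing O]
    (hO : (p : O) ^ 2 = 0) {k : ℤ} (hk : ¬ (p : ℤ) ∣ k) : IsUnit (k : O) := by
  have hcop : IsCoprime k ((p : ℤ) ^ 2) := by
    apply IsCoprime.pow_right
    exact ((Nat.prime_iff_prime_int.mp hp.out).coprime_iff_not_dvd.mpr hk).symm
  obtain ⟨a, b, hab⟩ := hcop
  have h := congrArg (Int.cast (R := O)) hab
  push_cast at h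
  rw [hO, mul_zero, add_zero] at h
  exact IsUnit.of_mul_eq_one_right _ h

lemma isUnit_two_and_isUnit_three {p : ℕ} [hp : Fact p.Prime] (h3 : 3 < p) {O : Type*} [CommRing O]
    (hO : (p : O) ^ 2 = 0) : IsUnit (2 : O) ∧ IsUnit (3 : O) := by
  constructor
  · have : ¬ (p : ℤ) ∣ 2 := fun h => by have := Int.le_of_dvd (by norm_num) h; omega
    exact_mod_cast isUnit_intCast_of_not_dvd hO this
  · have : ¬ (p : ℤ) ∣ 3 := fun h => by have := Int.le_of_dvd (by norm_num) h; omega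
    exact_mod_cast isUnit_intCast_of_not_dvd hO this

/-- The two congruences for integers `m`, `n`, `z` with
`12³ · 4m³ z ≡ 4m³ + 27n² (mod p²)`. -/
theorem cubic_sum_congruence {p : ℕ} [hp : Fact p.Prime] (h3 : 3 < p) {m n z : ℤ}
    (hm : ¬ (p : ℤ) ∣ m)
    (hz : (p : ℤ) ^ 2 ∣ 12 ^ 3 * (4 * m ^ 3) * z - (4 * m ^ 3 + 27 * n ^ 2)) {A : ℤ}
    (hA : A = ∑ y : ZMod p, quadraticChar (ZMod p) (y ^ 3 + m * y + n)) :
    (p : ℤ) ∣ A ^ 2 - quadraticChar (ZMod p) ((-3 * m : ℤ) : ZMod p) *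
        ∑ k ∈ Finset.range p, (sexticCubicCoeff k : ℤ) * z ^ k ∧
      (A = 0 → (p : ℤ) ^ 2 ∣ ∑ k ∈ Finset.range p, (sexticCubicCoeff k : ℤ) * z ^ k) := by
  obtain ⟨O, _, u, hu, hO⟩ := exists_quadratic_extension p h3 m
  have hp2 : (p : O) ^ 2 = 0 := by
    have := (hO ((p : ℤ) ^ 2)).mpr dvd_rfl
    exact_mod_cast this
  obtain ⟨h2u, h3u⟩ := isUnit_two_and_isUnit_three h3 hp2
  have hmu : IsUnit (m : O) := isUnit_intCast_of_not_dvd hp2 hm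
  have huu : IsUnit u := by
    have : IsUnit (3 * u ^ 2) := by rw [hu]; exact hmu.neg
    exact (isUnit_pow_iff two_ne_zero).mp (isUnit_of_mul_isUnit_right this)
  have h1728 : IsUnit (1728 * u ^ 3) := by
    have : IsUnit ((2 : O) ^ 6 * 3 ^ 3) := (h2u.pow 6).mul (h3u.pow 3)
    norm_num at this
    exact this.mul (huu.pow 3)
  obtain ⟨x, hx⟩ : ∃ x, 2 * u ^ 3 - n = 1728 * u ^ 3 * x := h1728.dvd
  have hzx : (z : O) = x - 432 * x ^ 2 := by
    have hz' := (hO _).mpr hz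
    push_cast at hz'
    have hm' : (m : O) = -3 * u ^ 2 := by linear_combination hu
    have hn' : (n : O) = 2 * u ^ 3 * (1 - 864 * x) := by linear_combination -hx
    have hunit : IsUnit (12 ^ 3 * (4 * (m : O) ^ 3)) := by
      have : IsUnit ((2 : O) ^ 8 * 3 ^ 3 * m ^ 3) := ((h2u.pow 8).mul (h3u.pow 3)).mul (hmu.pow 3)
      convert this using 1
      ring
    apply hunit.mul_left_cancel
    rw [hm', hn'] at hz'
    rw [hm']
    -- Both sides rest on `4m³ + 27n² = 108u⁶((1 - 864x)² - 1) = 12³·4m³(x - 432x²)`.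
    linear_combination hz'
  have hclausen := sum_sexticCoeff_sq h3 hp2 x
  rw [← hzx] at hclausen
  set f := ∑ k ∈ Finset.range p, (sexticCoeff k : O) * x ^ k with hf
  set I : Ideal O := Ideal.span {(p : O)} with hI
  have : CharP (O ⧸ I) p := by
    refine ⟨fun k => ?_⟩
    rw [← map_natCast (Ideal.Quotient.mk I), Ideal.Quotient.eq_zero_iff_mem, hI,
      Ideal.mem_span_singleton]
    constructor
    · rintro ⟨y, hy⟩
      -- Multiplying by `p` turns divisibility of `k` by `p` in `O` into `pk = 0` there, hence `p² ∣
      -- pk` in `ℤ`.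
      have : ((p * k : ℤ) : O) = 0 := by
        push_cast
        rw [hy]
        linear_combination y * hp2
      rw [hO, sq] at this
      exact_mod_cast Int.dvd_of_mul_dvd_mul_left (by exact_mod_cast hp.out.ne_zero) this
    · rintro ⟨y, rfl⟩
      exact ⟨y, by push_cast; ring⟩
  let _ : Algebra (ZMod p) (O ⧸ I) := ZMod.algebra (O ⧸ I) p
  let q := Ideal.Quotient.mk I
  have hm' : algebraMap (ZMod p) (O ⧸ I) (m : ZMod p) = -3 * q u ^ 2 := by
    have := congrArg q hu
    simp only [map_mul, map_pow, map_neg, map_ofNat, map_intCast] at this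
    rw [map_intCast]
    linear_combination this
  have hn' : algebraMap (ZMod p) (O ⧸ I) (n : ZMod p) = 2 * q u ^ 3 * (1 - 864 * q x) := by
    have := congrArg q hx
    simp only [map_mul, map_pow, map_sub, map_ofNat, map_intCast] at this
    rw [map_intCast]
    linear_combination -this
  have hsum := sum_quadraticChar_cubic h3 (huu.map q) hm' hn'
  have hqf : ∑ k ∈ Finset.range p, (sexticCoeff k : O ⧸ I) * q x ^ k = q f := by
    simp [hf]
  have hchar : ∀ a : ZMod p, ((quadraticChar (ZMod p) a : ℤ) : O ⧸ I) =
      algebraMap (ZMod p) (O ⧸ I) a ^ (p / 2) := by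
    intro a
    rw [← map_pow, ← map_intCast (algebraMap (ZMod p) (O ⧸ I)),
      quadraticChar_eq_pow_of_char_ne_two' (ringChar_zmod_ne_two h3), ZMod.card]
  rw [← hA, hqf, hchar, map_ofNat] at hsum
  constructor
  · rw [← CharP.intCast_eq_zero_iff (O ⧸ I) p]
    have hq := congrArg q hclausen
    simp only [map_pow, map_sum, map_mul, map_natCast, map_intCast] at hq
    have h9 : algebraMap (ZMod p) (O ⧸ I) ((-3 * m : ℤ) : ZMod p) = (3 * q u) ^ 2 := by
      rw [map_intCast] at hm' ⊢
      push_cast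
      rw [hm']
      ring
    rw [Int.cast_sub, Int.cast_mul, hchar, h9, Int.cast_pow, hsum]
    push_cast
    rw [← hq, pow_right_comm, mul_pow 3 (q u)]
    ring
  · intro hA0
    rw [hA0, Int.cast_zero, zero_eq_neg] at hsum
    have hf0 : q f = 0 := by
      have h1 : IsUnit (q u ^ (p / 2)) := (huu.map q).pow _
      have h2 : IsUnit ((3 : O ⧸ I) ^ (p / 2)) := by
        have := (h3u.map q).pow (p / 2)
        rwa [map_ofNat] at this
      rw [h1.mul_right_eq_zero, h2.mul_right_eq_zero] at hsum
      exact hsum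
    rw [Ideal.Quotient.eq_zero_iff_mem, hI, Ideal.mem_span_singleton] at hf0
    obtain ⟨y, hy⟩ := hf0
    -- Here `f = py`, so `f² = p²y² = 0` in `O`.
    rw [hy, mul_pow, hp2, zero_mul] at hclausen
    rw [← hO]
    push_cast
    exact hclausen.symm

/-! ### Arithmetic and congruences in `R_p` -/

section RationalCongruence

lemma mem_ratR_iff {p : ℕ} {a : ℚ} :
    a ∈ ratR p ↔ ∃ (j : ℤ) (d : ℕ), d ≠ 0 ∧ Nat.Coprime d p ∧ a * d = j := by
  constructor
  · intro h
    exact ⟨a.num, a.den, a.den_nz, h, Rat.mul_den_eq_num a⟩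
  · rintro ⟨j, d, hd, hcop, h⟩
    have ha : a = (j : ℚ) / ((d : ℤ) : ℚ) := by
      rw [eq_div_iff (by exact_mod_cast hd)]
      exact_mod_cast h
    have hdvd : a.den ∣ d := by
      rw [ha]
      exact_mod_cast Rat.den_dvd j d
    exact hcop.coprime_dvd_left hdvd

/-- `R_p` as a subring of `ℚ`. -/
def ratSubring (p : ℕ) : Subring ℚ where
  carrier := ratR p
  zero_mem' := mem_ratR_iff.mpr ⟨0, 1, one_ne_zero, Nat.coprime_one_left p, by simp⟩
  one_mem' := mem_ratR_iff.mpr ⟨1, 1, one_ne_zero, Nat.coprime_one_left p, by simp⟩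
  add_mem' := by
    intro a b ha hb
    obtain ⟨i, d, hd, hdp, h⟩ := mem_ratR_iff.mp ha
    obtain ⟨j, e, he, hep, h'⟩ := mem_ratR_iff.mp hb
    refine mem_ratR_iff.mpr ⟨i * e + j * d, d * e, mul_ne_zero hd he, hdp.mul_left hep, ?_⟩
    push_cast
    linear_combination (e : ℚ) * h + (d : ℚ) * h'
  mul_mem' := by
    intro a b ha hb
    obtain ⟨i, d, hd, hdp, h⟩ := mem_ratR_iff.mp ha
    obtain ⟨j, e, he, hep, h'⟩ := mem_ratR_iff.mp hb
    refine mem_ratR_iff.mpr ⟨i * j, d * e, mul_ne_zero hd he, hdp.mul_left hep, ?_⟩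
    push_cast
    rw [← h, ← h']
    ring
  neg_mem' := by
    intro a ha
    obtain ⟨i, d, hd, hdp, h⟩ := mem_ratR_iff.mp ha
    exact mem_ratR_iff.mpr ⟨-i, d, hd, hdp, by push_cast; linear_combination -h⟩

lemma mem_ratSubring {p : ℕ} {a : ℚ} : a ∈ ratSubring p ↔ a ∈ ratR p := Iff.rfl

variable {p N : ℕ} {a b c d : ℚ}

lemma RatCong.refl (a : ℚ) : RatCong p N a a :=
  ⟨0, (ratSubring p).zero_mem, by simp⟩

lemma RatCong.symm (h : RatCong p N a b) : RatCong p N b a := by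
  obtain ⟨x, hx, h⟩ := h
  exact ⟨-x, (ratSubring p).neg_mem hx, by linear_combination -h⟩

lemma RatCong.trans (h : RatCong p N a b) (h' : RatCong p N b c) : RatCong p N a c := by
  obtain ⟨x, hx, h⟩ := h
  obtain ⟨y, hy, h'⟩ := h'
  exact ⟨x + y, (ratSubring p).add_mem hx hy, by linear_combination h + h'⟩

lemma RatCong.add (h : RatCong p N a b) (h' : RatCong p N c d) :
    RatCong p N (a + c) (b + d) := by
  obtain ⟨x, hx, h⟩ := h
  obtain ⟨y, hy, h'⟩ := h'
  exact ⟨x + y, (ratSubring p).add_mem hx hy, by linear_combination h + h'⟩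

lemma RatCong.mul (h : RatCong p N a b) (h' : RatCong p N c d) (hc : c ∈ ratR p)
    (hb : b ∈ ratR p) : RatCong p N (a * c) (b * d) := by
  obtain ⟨x, hx, h⟩ := h
  obtain ⟨y, hy, h'⟩ := h'
  exact ⟨x * c + b * y, (ratSubring p).add_mem ((ratSubring p).mul_mem hx hc)
    ((ratSubring p).mul_mem hb hy), by linear_combination c * h + b * h'⟩

lemma RatCong.pow (h : RatCong p N a b) (ha : a ∈ ratR p) (hb : b ∈ ratR p) (k : ℕ) :
    RatCong p N (a ^ k) (b ^ k) := by
  induction k with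
  | zero => simpa using RatCong.refl 1
  | succ k ih =>
    rw [pow_succ, pow_succ]
    exact ih.mul h ha ((ratSubring p).pow_mem hb k)

lemma RatCong.sum {ι : Type*} {s : Finset ι} {f g : ι → ℚ}
    (h : ∀ i ∈ s, RatCong p N (f i) (g i)) : RatCong p N (∑ i ∈ s, f i) (∑ i ∈ s, g i) := by
  classical
  induction s using Finset.induction_on with
  | empty => simpa using RatCong.refl 0
  | insert i s hi ih =>
    rw [Finset.sum_insert hi, Finset.sum_insert hi]
    exact (h i (by simp)).add (ih fun j hj => h j (by simp [hj]))

lemma RatCong.of_sq (h : RatCong p (p ^ 2) a b) : RatCong p p a b := by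
  obtain ⟨x, hx, h⟩ := h
  refine ⟨p * x, (ratSubring p).mul_mem (natCast_mem _ p) hx, ?_⟩
  rw [h]
  push_cast
  ring

lemma RatCong.of_dvd {k l : ℤ} (h : (N : ℤ) ∣ k - l) : RatCong p N k l := by
  obtain ⟨x, hx⟩ := h
  exact ⟨x, mem_ratSubring.mp (intCast_mem _ x), by exact_mod_cast hx⟩

lemma RatCong.dvd {r : ℕ} {k l : ℤ} (h : RatCong p (p ^ r) k l) : (p : ℤ) ^ r ∣ k - l := by
  obtain ⟨x, hx, h⟩ := h
  obtain ⟨j, e, -, hep, he⟩ := mem_ratR_iff.mp hx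
  have h1 : (k - l) * (e : ℤ) = (p : ℤ) ^ r * j := by
    have : ((k - l) * e : ℚ) = (p : ℚ) ^ r * j := by
      rw [h, ← he]
      push_cast
      ring
    exact_mod_cast this
  have hcop : IsCoprime ((p : ℤ) ^ r) (e : ℤ) := (Nat.Coprime.isCoprime hep.symm).pow_left
  exact hcop.dvd_of_dvd_mul_right (Dvd.intro j h1.symm)

lemma exists_int_ratCong (ha : a ∈ ratR p) : ∃ k : ℤ, RatCong p (p ^ 2) a k := by
  obtain ⟨j, d, hd, hcop, h⟩ := mem_ratR_iff.mp ha
  have hcop' : IsCoprime ((p : ℤ) ^ 2) (d : ℤ) := (Nat.Coprime.isCoprime hcop.symm).pow_left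
  obtain ⟨x, y, hxy⟩ := hcop'
  have hxy' : (x : ℚ) * p ^ 2 + y * d = 1 := by exact_mod_cast hxy
  have hd' : (d : ℚ) ≠ 0 := by exact_mod_cast hd
  -- By Bézout `y` inverts the denominator `d` modulo `p²`, so `yj` represents `a = j/d`.
  refine ⟨y * j, x * a, (ratSubring p).mul_mem (intCast_mem _ x) ha, ?_⟩
  push_cast
  rw [← h]
  linear_combination -a * hxy'

variable [hp : Fact p.Prime]

lemma ratCast_eq_intCast {k : ℤ} (ha : a ∈ ratR p) (h : RatCong p p a k) :
    (a : ZMod p) = (k : ZMod p) := by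
  have hden : (a.den : ZMod p) ≠ 0 := by
    rw [Ne, ZMod.natCast_eq_zero_iff]
    exact (hp.out.coprime_iff_not_dvd).mp (Nat.Coprime.symm ha)
  have hdvd : (p : ℤ) ∣ a.num - k * a.den := by
    have : RatCong p (p ^ 1) (a.num : ℤ) ((k * a.den : ℤ) : ℚ) := by
      rw [pow_one]
      push_cast
      rw [← Rat.mul_den_eq_num a]
      exact h.mul (RatCong.refl _) (mem_ratSubring.mp (natCast_mem _ _))
        (mem_ratSubring.mp (intCast_mem _ _))
    simpa using this.dvd
  rw [Rat.cast_def, div_eq_iff hden, ← sub_eq_zero]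
  have := (ZMod.intCast_zmod_eq_zero_iff_dvd _ p).mpr hdvd
  exact_mod_cast this

lemma inv_mem_ratR (ha : a ∈ ratR p) (h0 : ¬ RatCong p p a 0) : a⁻¹ ∈ ratR p := by
  obtain ⟨j, d, hd, hcop, h⟩ := mem_ratR_iff.mp ha
  have hd' : (d : ℚ) ≠ 0 := by exact_mod_cast hd
  have ha0 : a ≠ 0 := fun ha0 => h0 (ha0 ▸ RatCong.refl _)
  have hj : ¬ (p : ℤ) ∣ j := by
    rintro ⟨i, rfl⟩
    apply h0
    refine ⟨i / d, mem_ratR_iff.mpr ⟨i, d, hd, hcop, by field_simp⟩, ?_⟩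
    push_cast at h
    field_simp
    linear_combination h
  rw [mem_ratR_iff]
  refine ⟨d * j.sign, j.natAbs, ?_, ?_, ?_⟩
  · rintro h'
    rw [Int.natAbs_eq_zero] at h'
    exact hj (h' ▸ dvd_zero _)
  · exact ((hp.out.coprime_iff_not_dvd).mpr fun hd => hj (Int.natCast_dvd.mpr hd)).symm
  · have : ((j.natAbs : ℤ) : ℚ) = j * j.sign := by
      exact_mod_cast (Int.mul_sign_self j).symm
    rw [Int.cast_natCast] at this
    rw [this, ← h]
    push_cast
    field_simp

end RationalCongruence

/-! ### Passage from `R_p` to integers modulo `p²` -/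

lemma binomSum_eq (N : ℕ) (z : ℚ) :
    binomSum N z = ∑ k ∈ Finset.range N, (sexticCubicCoeff k : ℚ) * z ^ k := rfl

lemma sum_range_natCast_zmod (p : ℕ) [hp : Fact p.Prime] (f : ZMod p → ℤ) :
    ∑ x ∈ Finset.range p, f (x : ZMod p) = ∑ y : ZMod p, f y := by
  refine Finset.sum_nbij' (fun x => (x : ZMod p)) (fun y => y.val) ?_ ?_ ?_ ?_ ?_
  · simp
  · intro y _
    exact Finset.mem_range.mpr y.val_lt
  · intro x hx
    exact ZMod.val_cast_of_lt (Finset.mem_range.mp hx)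
  · simp
  · simp

lemma ratLegendre_eq {p : ℕ} [Fact p.Prime] {a : ℚ} {k : ℤ} (ha : a ∈ ratR p)
    (h : RatCong p p a k) : ratLegendre p a = quadraticChar (ZMod p) (k : ZMod p) := by
  rw [ratLegendre, ratCast_eq_intCast ha h]

lemma cubicCharSum_eq {p : ℕ} [Fact p.Prime] {m n : ℚ} {k l : ℤ} (hm : m ∈ ratR p)
    (hn : n ∈ ratR p) (hk : RatCong p p m k) (hl : RatCong p p n l) :
    cubicCharSum p m n = ∑ y : ZMod p, quadraticChar (ZMod p) (y ^ 3 + k * y + l) := by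
  rw [← sum_range_natCast_zmod, cubicCharSum]
  apply Finset.sum_congr rfl
  intro x _
  have hx : (x : ℚ) ∈ ratR p := mem_ratSubring.mp (natCast_mem _ x)
  have hmem : (x : ℚ) ^ 3 + m * x + n ∈ ratR p :=
    (ratSubring p).add_mem ((ratSubring p).add_mem ((ratSubring p).pow_mem hx 3)
      ((ratSubring p).mul_mem hm hx)) hn
  rw [ratLegendre_eq (k := (x : ℤ) ^ 3 + k * x + l) hmem]
  · push_cast
    rfl
  · push_cast
    exact ((RatCong.refl _).add (hk.mul (RatCong.refl _) hx
      (mem_ratSubring.mp (intCast_mem _ k)))).add hl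

lemma binomSum_ratCong {p N : ℕ} {z w : ℚ} (hz : z ∈ ratR p) (hw : w ∈ ratR p)
    (h : RatCong p (p ^ 2) z w) : RatCong p (p ^ 2) (binomSum N z) (binomSum N w) := by
  rw [binomSum_eq, binomSum_eq]
  exact RatCong.sum fun k _ => (RatCong.refl _).mul (h.pow hz hw k)
    ((ratSubring p).pow_mem hz k) (mem_ratSubring.mp (natCast_mem _ _))

lemma binomSum_mem {p : ℕ} (N : ℕ) {z : ℚ} (hz : z ∈ ratR p) : binomSum N z ∈ ratR p := by
  rw [binomSum_eq, ← mem_ratSubring]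
  exact Subring.sum_mem _ fun k _ =>
    (ratSubring p).mul_mem (natCast_mem _ _) ((ratSubring p).pow_mem hz k)

lemma binomSum_truncate {p : ℕ} [Fact p.Prime] (h3 : 3 < p) {z : ℚ} (hz : z ∈ ratR p) :
    RatCong p p (binomSum p z) (binomSum (p / 6 + 1) z) := by
  have hsub : binomSum (p / 6 + 1) z = ∑ k ∈ Finset.range p,
      if k < p / 6 + 1 then (sexticCubicCoeff k : ℚ) * z ^ k else 0 := by
    rw [binomSum_eq, ← Finset.sum_filter]
    apply Finset.sum_congr _ fun _ _ => rfl
    ext k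
    simp only [Finset.mem_range, Finset.mem_filter]
    omega
  rw [hsub, binomSum_eq]
  apply RatCong.sum
  intro k hk
  split_ifs with h
  · exact RatCong.refl _
  · obtain ⟨c, hc⟩ := prime_dvd_sexticCubicCoeff h3 (show p / 6 < k by omega)
      (Finset.mem_range.mp hk)
    refine ⟨c * z ^ k, (ratSubring p).mul_mem (natCast_mem _ c) ((ratSubring p).pow_mem hz k), ?_⟩
    rw [hc]
    push_cast
    ring

theorem theorem4p2 (p : ℕ) [Fact p.Prime] (hp : 3 < p) (m n : ℚ)
    (hm : m ∈ ratR p) (hn : n ∈ ratR p) (hm0 : ¬ RatCong p p m 0) :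
    RatCong p p ((cubicCharSum p m n : ℚ) ^ 2)
        ((ratLegendre p (-3 * m) : ℚ) *
          binomSum p ((4 * m ^ 3 + 27 * n ^ 2) / (12 ^ 3 * (4 * m ^ 3)))) ∧
      RatCong p p
        ((ratLegendre p (-3 * m) : ℚ) *
          binomSum p ((4 * m ^ 3 + 27 * n ^ 2) / (12 ^ 3 * (4 * m ^ 3))))
        ((ratLegendre p (-3 * m) : ℚ) *
          binomSum (p / 6 + 1) ((4 * m ^ 3 + 27 * n ^ 2) / (12 ^ 3 * (4 * m ^ 3)))) ∧
      (cubicCharSum p m n = 0 →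
        RatCong p (p ^ 2)
          (binomSum p ((4 * m ^ 3 + 27 * n ^ 2) / (12 ^ 3 * (4 * m ^ 3)))) 0) := by
  set z := (4 * m ^ 3 + 27 * n ^ 2) / (12 ^ 3 * (4 * m ^ 3)) with hz
  have hint : ∀ k : ℤ, (k : ℚ) ∈ ratR p := fun k => mem_ratSubring.mp (intCast_mem _ k)
  have hm0' : m ≠ 0 := fun h => hm0 (h ▸ RatCong.refl _)
  have hpr : p.Prime := Fact.out
  have hnum : (4 * m ^ 3 + 27 * n ^ 2) ∈ ratSubring p :=
    add_mem (mul_mem (ofNat_mem _ 4) (pow_mem hm 3)) (mul_mem (ofNat_mem _ 27) (pow_mem hn 2))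
  have h6912 : ((6912 : ℚ))⁻¹ ∈ ratSubring p := by
    refine mem_ratR_iff.mpr ⟨1, 2 ^ 8 * 3 ^ 3, by norm_num, ?_, by norm_num⟩
    apply Nat.Coprime.mul_left
    · exact Nat.Coprime.pow_left _ ((Nat.coprime_primes Nat.prime_two hpr).mpr (by omega))
    · exact Nat.Coprime.pow_left _ ((Nat.coprime_primes Nat.prime_three hpr).mpr (by omega))
  have hzmem : z ∈ ratR p := by
    have : z = (4 * m ^ 3 + 27 * n ^ 2) * (6912⁻¹ * m⁻¹ ^ 3) := by
      rw [hz]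
      field_simp
      ring
    rw [this, ← mem_ratSubring]
    exact mul_mem hnum (mul_mem h6912 (pow_mem (inv_mem_ratR hm hm0) 3))
  obtain ⟨m', hm'⟩ := exists_int_ratCong hm
  obtain ⟨n', hn'⟩ := exists_int_ratCong hn
  obtain ⟨z', hz'⟩ := exists_int_ratCong hzmem
  have hm'0 : ¬ (p : ℤ) ∣ m' := fun h => hm0 <| hm'.of_sq.trans <| by
    have : RatCong p p (m' : ℚ) ((0 : ℤ) : ℚ) := RatCong.of_dvd (by simpa using h)
    simpa using this
  have hdvd : (p : ℤ) ^ 2 ∣ 12 ^ 3 * (4 * m' ^ 3) * z' - (4 * m' ^ 3 + 27 * n' ^ 2) := by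
    apply RatCong.dvd
    push_cast
    have e1 : RatCong p (p ^ 2) (12 ^ 3 * (4 * m ^ 3) * z) (12 ^ 3 * (4 * (m' : ℚ) ^ 3) * z') := by
      have := (RatCong.refl (p := p) (N := p ^ 2) 6912).mul (hm'.pow hm (hint m') 3)
        ((ratSubring p).pow_mem hm 3) (mem_ratSubring.mp (ofNat_mem _ 6912))
      have := this.mul hz' hzmem ((ratSubring p).mul_mem (ofNat_mem _ 6912)
        ((ratSubring p).pow_mem (hint m') 3))
      convert this using 1 <;> ring
    have e2 : RatCong p (p ^ 2) (4 * m ^ 3 + 27 * n ^ 2) (4 * (m' : ℚ) ^ 3 + 27 * (n' : ℚ) ^ 2) :=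
      ((RatCong.refl 4).mul (hm'.pow hm (hint m') 3)
        ((ratSubring p).pow_mem hm 3) (mem_ratSubring.mp (ofNat_mem _ 4))).add
      ((RatCong.refl 27).mul (hn'.pow hn (hint n') 2)
        ((ratSubring p).pow_mem hn 2) (mem_ratSubring.mp (ofNat_mem _ 27)))
    have e3 : 12 ^ 3 * (4 * m ^ 3) * z = 4 * m ^ 3 + 27 * n ^ 2 := by
      rw [hz, mul_div_cancel₀]
      positivity
    rw [e3] at e1
    exact e1.symm.trans e2
  obtain ⟨h1, h2⟩ := cubic_sum_congruence hp hm'0 hdvd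
    (cubicCharSum_eq hm hn hm'.of_sq hn'.of_sq)
  have hsum : binomSum p (z' : ℚ) =
      ((∑ k ∈ Finset.range p, (sexticCubicCoeff k : ℤ) * z' ^ k : ℤ) : ℚ) := by
    rw [binomSum_eq]
    push_cast
    rfl
  have hS := binomSum_ratCong (N := p) hzmem (hint z') hz'
  have hleg : ratLegendre p (-3 * m) =
      quadraticChar (ZMod p) ((-3 * m' : ℤ) : ZMod p) := by
    apply ratLegendre_eq ((ratSubring p).mul_mem (neg_mem (ofNat_mem _ 3)) hm)
    push_cast
    exact (RatCong.refl _).mul hm'.of_sq hm (mem_ratSubring.mp (neg_mem (ofNat_mem _ 3)))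
  refine ⟨?_, ?_, fun h0 => ?_⟩
  · have e := RatCong.of_dvd (p := p) h1
    rw [← hleg] at e
    push_cast at e
    refine e.trans ?_
    push_cast at hsum
    rw [← hsum]
    exact (RatCong.refl _).mul hS.of_sq.symm (binomSum_mem p (hint z')) (hint _)
  · exact (RatCong.refl _).mul (binomSum_truncate hp hzmem) (binomSum_mem _ hzmem) (hint _)
  · refine hS.trans ?_
    rw [hsum]
    have := RatCong.of_dvd (p := p) (N := p ^ 2) (l := 0) (by simpa using h2 h0)
    simpa using this
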